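/- A machine is an effective transition system: it takes a binary string (a program) as input, computes an initial configuration from it, moves from configuration to configuration by a computable step function until it reaches a halting configuration (if ever), and then outputs a natural number computed from that configuration; the running time of a terminating program is the number of steps made. (Turing machines of all kinds are special cases.) A partial computable function from binary strings to natural numbers is \emph{prefix-free} if no string in its domain is a proper prefix of another string in its domain; a prefix-free partial computable function $U$ is \emph{optimal} if for every prefix-free partial computable function $V$ there is a constant $c_V$ such that whenever $V(p)=n$, there is $q$ with $U(q)=n$ and $|q|\le |p|+c_V$. A machine is an optimal prefix-free machine if the partial function it computes is prefix-free and optimal. Let $U$ be an optimal prefix-free partial computable function, let the prefix complexity $\mathrm{KP}(n)$ be the minimal length of a $p$ with $U(p)=n$, and for an integer $m$ let $BP(m)$ be the minimal natural number $N$ such that $\mathrm{KP}(n)>m$ for all $n>N$ (so $BP(m)=0$ for $m<0$). Let $M$ be an optimal prefix-free machine (for example, one computing $U$), and let $T(m)$ be the maximal running time on $M$ of the terminating programs of length at most $m$ (with $T(m)=0$ if there are none). Then there is a constant $c$ such that for all natural numbers $m$ $$BP(m-c)\le T(m)\le BP(m+c).$$ -/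

import Mathlib

namespace PrefixBusyBeaver

/-- A machine model with a step count: an effective transition system. Configurations are
effectively coded, the initial configuration is computed from the program (a binary string), and
one step of the machine is a computable function that returns `none` exactly at the halting
configurations, from which the output is read. Turing machines of every kind (any number of tapes
or heads, self-delimiting input), register machines and the like are particular cases. -/
structure Machine where
  Cfg : Type
  [primcodable : Primcodable Cfg]
  init : List Bool → Cfg
  step : Cfg → Option Cfg
  output : Cfg → ℕ
  init_computable : Computable init
  step_computable : Computable step
  output_computable : Computable output

attribute [instance] Machine.primcodable

namespace Machine

variable (M : Machine)

/-- The configuration after exactly `t` steps on program `p`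
(`none` if the machine has halted before). -/
def run (p : List Bool) : ℕ → Option M.Cfg
  | 0 => some (M.init p)
  | t + 1 => (run p t).bind M.step

/-- The output of program `p` if it terminates after exactly `t` steps, and `none` otherwise. -/
def outputAt (p : List Bool) (t : ℕ) : Option ℕ :=
  (M.run p t).bind fun c => if (M.step c).isNone then some (M.output c) else none

/-- Program `p` terminates, and its running time is `t`. -/
def HaltsIn (p : List Bool) (t : ℕ) : Prop :=
  (M.outputAt p t).isSome

/-- The partial function computed by the machine. -/
def eval (p : List Bool) : Part ℕ :=
  Nat.rfindOpt (M.outputAt p)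

/-- `T(m)`: the maximal running time of the terminating programs of length at most `m`
(`0` if there are none). -/
noncomputable def maxTime (m : ℕ) : ℕ :=
  sSup {t | ∃ p : List Bool, p.length ≤ m ∧ M.HaltsIn p t}

end Machine

/-- A prefix-free partial computable function: no program in its domain is a proper prefix of
another one. -/
structure IsPrefixFree (f : List Bool →. ℕ) : Prop where
  partrec : Partrec f
  prefix_free : ∀ p q : List Bool, (f p).Dom → (f q).Dom → p <+: q → p = q

/-- An optimal prefix-free partial computable function: up to an additive constant, its programs
are not longer than those of any other prefix-free partial computable function. -/
structure IsOptimal (f : List Bool →. ℕ) : Prop where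
  isPrefixFree : IsPrefixFree f
  optimal : ∀ g : List Bool →. ℕ, IsPrefixFree g →
    ∃ c : ℕ, ∀ p n, n ∈ g p → ∃ q : List Bool, n ∈ f q ∧ q.length ≤ p.length + c

/-- The prefix complexity of `n` with respect to `f`: the length of a shortest program for `n`. -/
noncomputable def KP (f : List Bool →. ℕ) (n : ℕ) : ℕ :=
  sInf {k | ∃ p : List Bool, p.length = k ∧ n ∈ f p}

/-- `BP(m)`: the minimal `N` such that `KP(n) > m` for all `n > N`. An integer argument makes
`BP(m - c)` meaningful for `m < c` (its value is then `0`). -/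
noncomputable def BP (f : List Bool →. ℕ) (m : ℤ) : ℕ :=
  sInf {N | ∀ n, N < n → m < (KP f n : ℤ)}

/-! The minima and maxima above exist, so no default value is involved. -/

theorem Machine.HaltsIn.unique {M : Machine} {p : List Bool} {s t : ℕ}
    (hs : M.HaltsIn p s) (ht : M.HaltsIn p t) : s = t := by
  have key : ∀ s t, M.HaltsIn p s → M.HaltsIn p t → ¬ s < t := by
    intro s t hs ht hst
    have h0 : ∀ d, M.run p (s + 1 + d) = none := by
      intro d
      induction d with
      | zero =>
        simp only [HaltsIn, outputAt] at hs
        cases h : M.run p s with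
        | none => simp [h] at hs
        | some c => cases h' : M.step c <;> simp_all [run]
      | succ d ih =>
        have : M.run p (s + 1 + (d + 1)) = (M.run p (s + 1 + d)).bind M.step := rfl
        rw [this, ih]; rfl
    have := h0 (t - (s + 1))
    rw [show s + 1 + (t - (s + 1)) = t by omega] at this
    simp [HaltsIn, outputAt, this] at ht
  have h1 := key s t hs ht
  have h2 := key t s ht hs
  omega

theorem Machine.bddAbove_times (M : Machine) (m : ℕ) :
    BddAbove {t | ∃ p : List Bool, p.length ≤ m ∧ M.HaltsIn p t} := by
  apply Set.Finite.bddAbove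
  have : {t | ∃ p : List Bool, p.length ≤ m ∧ M.HaltsIn p t}
      = ⋃ p ∈ {p : List Bool | p.length ≤ m}, {t | M.HaltsIn p t} := by
    ext t; simp
  rw [this]
  exact (List.finite_length_le Bool m).biUnion fun p _ =>
    Set.Subsingleton.finite fun _ hs _ ht => Machine.HaltsIn.unique hs ht

theorem IsOptimal.exists_program {f : List Bool →. ℕ} (hf : IsOptimal f) (n : ℕ) :
    ∃ p : List Bool, p.length = KP f n ∧ n ∈ f p := by
  have hg : IsPrefixFree (fun p : List Bool => (Part.ofOption (if p = [] then some n else none))) := by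
    refine ⟨?_, ?_⟩
    · refine Computable.ofOption (Primrec.to_comp ?_)
      exact Primrec.ite (Primrec.eq.comp Primrec.id (Primrec.const _))
        (Primrec.const _) (Primrec.const _)
    · intro p q hp hq _
      by_cases h1 : p = [] <;> by_cases h2 : q = [] <;> simp_all
  obtain ⟨c, hc⟩ := hf.optimal _ hg
  obtain ⟨q, hq, _⟩ := hc [] n (by simp)
  exact Nat.sInf_mem (s := {k | ∃ p : List Bool, p.length = k ∧ n ∈ f p}) ⟨_, q, rfl, hq⟩

theorem IsOptimal.bP_set_nonempty {f : List Bool →. ℕ} (hf : IsOptimal f) (m : ℤ) :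
    {N | ∀ n, N < n → m < (KP f n : ℤ)}.Nonempty := by
  have hfin : {n | (KP f n : ℤ) ≤ m}.Finite := by
    have : {n | (KP f n : ℤ) ≤ m}
        ⊆ ⋃ p ∈ {p : List Bool | p.length ≤ m.toNat}, {n | n ∈ f p} := by
      intro n hn
      obtain ⟨p, hp, hnp⟩ := hf.exists_program n
      simp only [Set.mem_ofPred_eq] at hn
      simp only [Set.mem_iUnion, Set.mem_ofPred_eq]
      exact ⟨p, by omega, hnp⟩
    exact ((List.finite_length_le Bool _).biUnion fun p _ =>
      Set.Subsingleton.finite (s := {n | n ∈ f p}) fun _ hs _ ht => Part.mem_unique hs ht).subset this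
  obtain ⟨N, hN⟩ := hfin.bddAbove
  refine ⟨N, fun n hn => ?_⟩
  by_contra h
  have := hN (show n ∈ {n | (KP f n : ℤ) ≤ m} from not_lt.mp h)
  omega

end PrefixBusyBeaver

namespace PrefixBusyBeaver

namespace Machine

variable (M : Machine)

theorem run_computable : Computable₂ M.run := by
  have h : Computable fun x : List Bool × ℕ =>
      (Nat.rec (some (M.init x.1)) (fun _ c => c.bind M.step) x.2 : Option M.Cfg) := by
    refine Computable.nat_rec (h := fun _ y => y.2.bind M.step) Computable.snd
      (Computable.option_some.comp (M.init_computable.comp Computable.fst)) ?_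
    exact Computable.option_bind (Computable.snd.comp Computable.snd)
      (M.step_computable.comp Computable.snd)
  refine h.of_eq fun x => ?_
  obtain ⟨p, t⟩ := x
  induction t with
  | zero => rfl
  | succ t ih => exact congrArg (fun c : Option M.Cfg => c.bind M.step) ih

theorem outputAt_computable : Computable₂ M.outputAt := by
  refine Computable.option_bind M.run_computable ?_
  have h : Computable fun c : M.Cfg =>
      bif (M.step c).isNone then some (M.output c) else none :=
    Computable.cond
      ((Primrec.not.comp Primrec.option_isSome).to_comp.comp M.step_computable |>.of_eq
        fun c => by cases M.step c <;> rfl)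
      (Computable.option_some.comp M.output_computable) (Computable.const none)
  refine (h.comp Computable.snd).of_eq fun x => ?_
  simp [Bool.cond_eq_ite]

/-- The running time of a program, as a partial function. -/
def time (p : List Bool) : Part ℕ :=
  Nat.rfind fun t => Part.some (M.outputAt p t).isSome

theorem time_partrec : Partrec M.time :=
  Partrec.rfind
    (p := fun (p : List Bool) (t : ℕ) => Part.some (M.outputAt p t).isSome)
    (Primrec.option_isSome.to_comp.comp M.outputAt_computable).partrec

variable {M}

theorem haltsIn_iff_mem_time {p : List Bool} {t : ℕ} : M.HaltsIn p t ↔ t ∈ M.time p := by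
  have spec : ∀ s, s ∈ M.time p → M.HaltsIn p s := fun s hs => by
    simpa [HaltsIn] using Nat.rfind_spec hs
  refine ⟨fun h => ?_, spec t⟩
  have hd : (M.time p).Dom :=
    Nat.rfind_dom.2 ⟨t, by simpa [HaltsIn] using h, fun _ => trivial⟩
  have hm := Part.get_mem hd
  rwa [(spec _ hm).unique h] at hm

theorem haltsIn_of_outputAt {p : List Bool} {t n : ℕ} (h : M.outputAt p t = some n) :
    M.HaltsIn p t := by
  simp [HaltsIn, h]

theorem exists_outputAt_of_mem_eval {p : List Bool} {n : ℕ} (h : n ∈ M.eval p) :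
    ∃ t, M.outputAt p t = some n :=
  Nat.rfindOpt_spec h

theorem HaltsIn.eval_dom {p : List Bool} {t : ℕ} (h : M.HaltsIn p t) : (M.eval p).Dom := by
  obtain ⟨n, hn⟩ := Option.isSome_iff_exists.1 h
  exact Nat.rfindOpt_dom.2 ⟨t, n, hn⟩

theorem time_isPrefixFree (h : IsPrefixFree M.eval) : IsPrefixFree M.time :=
  ⟨M.time_partrec, fun p q hp hq =>
    h.prefix_free p q (haltsIn_iff_mem_time.2 (Part.get_mem hp)).eval_dom
      (haltsIn_iff_mem_time.2 (Part.get_mem hq)).eval_dom⟩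

theorem HaltsIn.le_maxTime {p : List Bool} {t m : ℕ} (h : M.HaltsIn p t) (hp : p.length ≤ m) :
    t ≤ M.maxTime m :=
  le_csSup (M.bddAbove_times m) ⟨p, hp, h⟩

theorem maxTime_mono : Monotone M.maxTime := fun m m' hm => by
  rcases Set.eq_empty_or_nonempty {t | ∃ p : List Bool, p.length ≤ m ∧ M.HaltsIn p t} with h | h
  · simp [maxTime, h]
  · exact csSup_le h fun t ⟨p, hp, ht⟩ => ht.le_maxTime (hp.trans hm)

variable (M)

/-- The configuration after `n` steps on program `p`, where a halting configuration is kept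
forever. -/
def settle (p : List Bool) (n : ℕ) : M.Cfg :=
  Nat.rec (M.init p) (fun _ c => (M.step c).getD c) n

theorem settle_computable : Computable₂ M.settle := by
  refine Computable.nat_rec (f := fun x : List Bool × ℕ => x.2)
    (h := fun _ y => (M.step y.2).getD y.2) Computable.snd
    (M.init_computable.comp Computable.fst) ?_
  exact Computable.option_getD (M.step_computable.comp (Computable.snd.comp Computable.snd))
    (Computable.snd.comp Computable.snd)

variable {M}

theorem settle_eq_of_run {p : List Bool} {t : ℕ} {c : M.Cfg} (h : M.run p t = some c) :
    M.settle p t = c := by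
  induction t generalizing c with
  | zero => simpa [run, settle] using h
  | succ t ih =>
    obtain ⟨d, hd, hc⟩ := Option.bind_eq_some_iff.1 (show (M.run p t).bind M.step = some c from h)
    change (M.step (M.settle p t)).getD (M.settle p t) = c
    rw [ih hd, hc]
    rfl

theorem output_settle {p : List Bool} {t n x : ℕ} (h : M.outputAt p t = some x) (htn : t ≤ n) :
    M.output (M.settle p n) = x := by
  obtain ⟨c, hc, hx⟩ := Option.bind_eq_some_iff.1 h
  have hs : M.step c = none := by
    by_contra hne
    simp [hne] at hx
  have hn : M.settle p n = c := by
    induction n, htn using Nat.le_induction with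
    | base => exact settle_eq_of_run hc
    | succ n _ ih =>
      change (M.step (M.settle p n)).getD (M.settle p n) = c
      rw [ih, hs]
      rfl
  simpa [hn, hs] using hx

end Machine

/-- A bound for the codes of binary strings of a given length. -/
def codeBound (l : ℕ) : ℕ :=
  Nat.rec 0 (fun _ b => Nat.pair 1 b + 1) l

theorem codeBound_computable : Computable codeBound :=
  Computable.nat_rec (f := fun l : ℕ => l) (h := fun _ y => Nat.pair 1 y.2 + 1) Computable.id
    (Computable.const 0)
    (Primrec.succ.to_comp.comp (Primrec₂.natPair.to_comp.comp (Computable.const 1)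
      (Computable.snd.comp Computable.snd)))

theorem encode_le_codeBound {p : List Bool} {l : ℕ} (h : p.length ≤ l) :
    Encodable.encode p ≤ codeBound l := by
  induction l generalizing p with
  | zero => simp [List.length_eq_zero_iff.1 (Nat.le_zero.1 h)]
  | succ l ih =>
    cases p with
    | nil => simp
    | cons a p =>
      have hp := ih (p := p) (by simpa using h)
      have ha : Encodable.encode a ≤ 1 := by cases a <;> simp
      rw [Encodable.encode_list_cons]
      have h₁ : Nat.pair (Encodable.encode a) (Encodable.encode p) ≤
          Nat.pair 1 (Encodable.encode p) := by
        rcases ha.lt_or_eq with h | h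
        · exact (Nat.pair_lt_pair_left _ h).le
        · rw [h]
      have h₂ : Nat.pair 1 (Encodable.encode p) ≤ Nat.pair 1 (codeBound l) := by
        rcases hp.lt_or_eq with h | h
        · exact (Nat.pair_lt_pair_right _ h).le
        · rw [h]
      exact Nat.succ_le_succ (h₁.trans h₂)

namespace Machine

variable (M : Machine)

/-- The number that the program with code `i` would output after `n` steps. -/
def outputOfCode (n i : ℕ) : ℕ :=
  M.output (M.settle ((Encodable.decode (α := List Bool) i).getD []) n)

theorem outputOfCode_computable : Computable₂ M.outputOfCode :=
  M.output_computable.comp (M.settle_computable.comp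
    (Computable.option_getD (Computable.decode.comp Computable.snd) (Computable.const []))
    Computable.fst)

/-- A number larger than the outputs of all programs of length at most `l` that terminate within
`n` steps. -/
def largeNumber (l n : ℕ) : ℕ :=
  Nat.rec 1 (fun i s => s + M.outputOfCode n i) (codeBound l + 1)

theorem largeNumber_computable : Computable₂ M.largeNumber := by
  refine Computable.nat_rec (f := fun x : ℕ × ℕ => codeBound x.1 + 1)
    (h := fun x y => y.2 + M.outputOfCode x.2 y.1)
    (Primrec.succ.to_comp.comp (codeBound_computable.comp Computable.fst))
    (Computable.const 1) ?_
  exact Primrec.nat_add.to_comp.comp (Computable.snd.comp Computable.snd)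
    (M.outputOfCode_computable.comp (Computable.snd.comp Computable.fst)
      (Computable.fst.comp Computable.snd))

variable {M}

theorem lt_largeNumber {p : List Bool} {l n t x : ℕ} (hp : p.length ≤ l)
    (hx : M.outputAt p t = some x) (ht : t ≤ n) : x < M.largeNumber l n := by
  have key : ∀ b i, i < b →
      M.outputOfCode n i < (Nat.rec 1 (fun i s => s + M.outputOfCode n i) b : ℕ) := by
    have pos : ∀ b, 0 < (Nat.rec 1 (fun i s => s + M.outputOfCode n i) b : ℕ) := fun b => by
      induction b with
      | zero => exact Nat.one_pos
      | succ b ih => exact Nat.add_pos_left ih _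
    intro b
    induction b with
    | zero => intro i hi; omega
    | succ b ih =>
      intro i hi
      change _ < (Nat.rec 1 (fun i s => s + M.outputOfCode n i) b : ℕ) + M.outputOfCode n b
      rcases Nat.lt_succ_iff_lt_or_eq.1 hi with h | rfl
      · exact (ih i h).trans_le (Nat.le_add_right _ _)
      · exact Nat.lt_add_of_pos_left (pos _)
  have hc : M.outputOfCode n (Encodable.encode p) = x := by
    simp [outputOfCode, Encodable.encodek, output_settle hx ht]
  exact hc ▸ key (codeBound l + 1) (Encodable.encode p)
    (Nat.lt_succ_of_le (encode_le_codeBound hp))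

end Machine

/-- Splits `1ʲ0p` into `j` and `p`. -/
def unaryPrefix (q : List Bool) : Option (ℕ × List Bool) :=
  List.rec none (fun b l r => bif b then r.map fun x => (x.1 + 1, x.2) else some (0, l)) q

theorem unaryPrefix_primrec : Primrec unaryPrefix := by
  refine Primrec.list_rec (f := fun q : List Bool => q) (g := fun _ => none)
    (h := fun _ y => bif y.1 then y.2.2.map fun x : ℕ × List Bool => (x.1 + 1, x.2)
      else some (0, y.2.1)) Primrec.id (Primrec.const none) ?_
  refine Primrec.cond (Primrec.fst.comp Primrec.snd) ?_ ?_
  · refine Primrec.option_map (Primrec.snd.comp (Primrec.snd.comp Primrec.snd)) ?_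
    exact Primrec.pair (Primrec.succ.comp (Primrec.fst.comp Primrec.snd))
      (Primrec.snd.comp Primrec.snd)
  · exact Primrec.option_some.comp (Primrec.pair (Primrec.const 0)
      (Primrec.fst.comp (Primrec.snd.comp Primrec.snd)))

theorem unaryPrefix_eq_some {q p : List Bool} {j : ℕ} :
    unaryPrefix q = some (j, p) ↔ q = List.replicate j true ++ false :: p := by
  induction q generalizing j with
  | nil => simp [unaryPrefix]
  | cons b q ih =>
    cases b with
    | false =>
      change some (0, q) = some (j, p) ↔ _
      cases j <;> simp [List.replicate_succ]
    | true =>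
      change (unaryPrefix q).map (fun x => (x.1 + 1, x.2)) = some (j, p) ↔ _
      cases j with
      | zero => simp
      | succ j => simp [List.replicate_succ, ← ih]

theorem prefix_of_unary_prefix {i j : ℕ} {p q : List Bool}
    (h : List.replicate i true ++ false :: p <+: List.replicate j true ++ false :: q) :
    i = j ∧ p <+: q := by
  induction i generalizing j with
  | zero =>
    cases j with
    | zero => simpa using h
    | succ j => simp [List.replicate_succ] at h
  | succ i ih =>
    cases j with
    | zero => simp [List.replicate_succ] at h
    | succ j => simpa using ih (j := j) (by simpa [List.replicate_succ] using h)

/-- Precomposing a prefix-free function with the self-delimiting unary code of a parameter `j`,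
and postcomposing it with a computable function that may depend on `j` and the program. -/
theorem IsPrefixFree.unaryParam {f : List Bool →. ℕ} (hf : IsPrefixFree f)
    {F : ℕ × List Bool → ℕ → ℕ} (hF : Computable₂ F) :
    IsPrefixFree fun q => (unaryPrefix q : Part (ℕ × List Bool)).bind fun x =>
      (f x.2).map (F x) := by
  refine ⟨?_, fun q q' hq hq' hqq' => ?_⟩
  · refine Partrec.bind unaryPrefix_primrec.to_comp.ofOption ?_
    refine Partrec.map (hf.partrec.comp (Computable.snd.comp Computable.snd)) ?_
    exact hF.comp (Computable.snd.comp Computable.fst) Computable.snd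
  · have split : ∀ {q : List Bool}, ((unaryPrefix q : Part (ℕ × List Bool)).bind fun x =>
        (f x.2).map (F x)).Dom →
        ∃ j p, q = List.replicate j true ++ false :: p ∧ (f p).Dom := fun {q} hq => by
      obtain ⟨y, hy⟩ := Part.dom_iff_mem.1 hq
      obtain ⟨⟨j, p⟩, hx, hy⟩ := Part.mem_bind_iff.1 hy
      obtain ⟨n, hn, -⟩ := (Part.mem_map_iff _).1 hy
      exact ⟨j, p, unaryPrefix_eq_some.1 (Part.mem_ofOption.1 hx), Part.dom_iff_mem.2 ⟨n, hn⟩⟩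
    obtain ⟨j, p, rfl, hp⟩ := split hq
    obtain ⟨j', p', rfl, hp'⟩ := split hq'
    obtain ⟨rfl, h⟩ := prefix_of_unary_prefix hqq'
    rw [hf.prefix_free p p' hp hp' h]

/-- The output of a program is exceeded by the maximal running time of the programs that are longer
by a constant. -/
theorem IsOptimal.lt_maxTime {M : Machine} (hM : IsOptimal M.eval) {f : List Bool →. ℕ}
    (hf : IsPrefixFree f) :
    ∃ c : ℕ, ∀ p n, n ∈ f p → n < M.maxTime (p.length + c) := by
  have hF : Computable₂ fun (x : ℕ × List Bool) n =>
      M.largeNumber (x.2.length + (x.1 + x.1)) n := by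
    have hj : Computable fun y : (ℕ × List Bool) × ℕ => y.1.1 :=
      Computable.fst.comp Computable.fst
    exact M.largeNumber_computable.comp
      (Primrec.nat_add.to_comp.comp
        (Computable.list_length.comp (Computable.snd.comp Computable.fst))
        (Primrec.nat_add.to_comp.comp hj hj)) Computable.snd
  obtain ⟨d, hd⟩ := hM.optimal _ (hf.unaryParam hF)
  refine ⟨(d + 1) + (d + 1), fun p n hn => ?_⟩
  by_contra! hT
  obtain ⟨q, hq, hlen⟩ := hd (List.replicate (d + 1) true ++ false :: p)
    (M.largeNumber (p.length + ((d + 1) + (d + 1))) n)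
    (Part.mem_bind (Part.mem_ofOption.2 (unaryPrefix_eq_some.2 rfl)) (Part.mem_map _ hn))
  obtain ⟨t, ht⟩ := Machine.exists_outputAt_of_mem_eval hq
  have hl : q.length ≤ p.length + ((d + 1) + (d + 1)) := by
    simp only [List.length_append, List.length_replicate, List.length_cons] at hlen
    omega
  exact lt_irrefl _ (Machine.lt_largeNumber hl ht
    (((Machine.haltsIn_of_outputAt ht).le_maxTime hl).trans hT))

theorem KP_le {f : List Bool →. ℕ} {p : List Bool} {n : ℕ} (h : n ∈ f p) : KP f n ≤ p.length :=
  Nat.sInf_le ⟨p, rfl, h⟩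

theorem BP_le {f : List Bool →. ℕ} {m : ℤ} {N : ℕ} (h : ∀ n, (KP f n : ℤ) ≤ m → n ≤ N) :
    BP f m ≤ N :=
  Nat.sInf_le fun n hn => not_le.1 fun hk => (h n hk).not_gt hn

theorem IsOptimal.le_BP {f : List Bool →. ℕ} (hf : IsOptimal f) {m : ℤ} {n : ℕ}
    (h : (KP f n : ℤ) ≤ m) : n ≤ BP f m :=
  not_lt.1 fun hn => (Nat.sInf_mem (hf.bP_set_nonempty m) n hn).not_ge h

theorem IsOptimal.BP_mono {f : List Bool →. ℕ} (hf : IsOptimal f) : Monotone (BP f) :=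
  fun _ _ h => BP_le fun _ hn => hf.le_BP (hn.trans h)

theorem IsOptimal.exists_BP_sub_le_maxTime {M : Machine} (hM : IsOptimal M.eval)
    {f : List Bool →. ℕ} (hf : IsOptimal f) :
    ∃ c : ℕ, ∀ m : ℕ, BP f ((m : ℤ) - c) ≤ M.maxTime m := by
  obtain ⟨c, hc⟩ := hM.lt_maxTime hf.isPrefixFree
  refine ⟨c, fun m => BP_le fun n hn => ?_⟩
  obtain ⟨p, hp, hnp⟩ := hf.exists_program n
  exact (hc p n hnp).le.trans (Machine.maxTime_mono (by omega))

theorem IsOptimal.exists_maxTime_le_BP_add {f : List Bool →. ℕ} (hf : IsOptimal f) {M : Machine}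
    (hM : IsPrefixFree M.eval) :
    ∃ c : ℕ, ∀ m : ℕ, M.maxTime m ≤ BP f ((m : ℤ) + c) := by
  obtain ⟨c, hc⟩ := hf.optimal _ (Machine.time_isPrefixFree hM)
  refine ⟨c, fun m => ?_⟩
  rcases Set.eq_empty_or_nonempty {t | ∃ p : List Bool, p.length ≤ m ∧ M.HaltsIn p t} with h | h
  · simp [Machine.maxTime, h]
  · refine csSup_le h fun t ⟨p, hp, ht⟩ => ?_
    obtain ⟨q, hq, hlen⟩ := hc p t (Machine.haltsIn_iff_mem_time.1 ht)
    have := KP_le hq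
    exact hf.le_BP (by omega)

end PrefixBusyBeaver

theorem mainTheorem11 (M : PrefixBusyBeaver.Machine) (hM : PrefixBusyBeaver.IsOptimal M.eval)
    (U : List Bool →. ℕ) (hU : PrefixBusyBeaver.IsOptimal U) :
    ∃ c : ℕ, ∀ m : ℕ,
      PrefixBusyBeaver.BP U ((m : ℤ) - (c : ℤ)) ≤ M.maxTime m ∧
      M.maxTime m ≤ PrefixBusyBeaver.BP U ((m : ℤ) + (c : ℤ)) := by
  obtain ⟨a, ha⟩ := hM.exists_BP_sub_le_maxTime hU
  obtain ⟨b, hb⟩ := hU.exists_maxTime_le_BP_add hM.isPrefixFree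
  refine ⟨max a b, fun m => ⟨(hU.BP_mono ?_).trans (ha m), (hb m).trans (hU.BP_mono ?_)⟩⟩
  · have := le_max_left a b
    omega
  · have := le_max_right a b
    omega
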